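/- Let $\mathcal X$ be a nonsingular, projective, geometrically irreducible curve over the finite field $\mathbb F_q$ with $q$ elements, with function field $\mathbb F_q(\mathcal X)$, let $m\ge 2$, and let $\mathbf Q=(Q_1,\dots,Q_m)$ be an $m$-tuple of pairwise distinct rational points of $\mathcal X$. For a point $P$, let $v_P$ be the associated normalized discrete valuation. Let $H(\mathbf Q)$ be the set of all $\alpha\in\mathbb N_0^m$ for which there is $h\in\mathbb F_q(\mathcal X)^\times$ with divisor of poles exactly $\sum_{i=1}^m\alpha_iQ_i$, and let $G(\mathbf Q)=\mathbb N_0^m\setminus H(\mathbf Q)$ be the set of Weierstrass gaps at $\mathbf Q$. Let $$\widehat H(\mathbf Q)=\{(-v_{Q_1}(h),\dots,-v_{Q_m}(h)) : h\in\mathbb F_q(\mathcal X)^\times \text{ regular outside } \{Q_1,\dots,Q_m\}\}\subseteq\mathbb Z^m$$ be the generalized Weierstrass semigroup. Put $I=\{1,\dots,m\}$. For $\alpha\in\mathbb Z^m$ and nonempty $J\subsetneq I$, let $\overline\nabla_J(\alpha)$ be the set of $\beta\in\mathbb Z^m$ with $\beta_j=\alpha_j$ for $j\in J$ and $\beta_i<\alpha_i$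 for $i\in I\setminus J$. Let $\overline\nabla(\alpha)=\bigcup_{i=1}^m\overline\nabla_{\{i\}}(\alpha)$. An element $\alpha\in\widehat H(\mathbf Q)$ is called relative maximal if $\overline\nabla(\alpha)\cap\widehat H(\mathbf Q)=\emptyset$ and $\overline\nabla_J(\alpha)\cap\widehat H(\mathbf Q)\ne\emptyset$ for every $J\subsetneq I$ with $\#J\ge 2$. Let $\Lambda(\mathbf Q)$ be the set of relative maximal elements of $\widehat H(\mathbf Q)$ that lie in $\mathbb N_0^m$. **Theorem.** If $q\ge m$, then $$G(\mathbf Q)=\bigcup_{\beta^*\in\Lambda(\mathbf Q)}\bigl(\overline\nabla(\beta^*)\cap\mathbb N_0^m\bigr).$$ -/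

import Mathlib

open scoped IntermediateField

noncomputable section

namespace AlgCurve

/-- `K` is the function field of a (nonsingular, projective, geometrically irreducible) curve over
the finite field `F`: it is a finite extension of `F(x)` for some `x` transcendental over `F`,
and `F` is algebraically closed in `K` (over a perfect field this is geometric irreducibility).
The curve itself is recovered as the set of all places of `K` over `F`. -/
class IsCurveFunctionField (F K : Type*) [Field F] [Field K] [Algebra F K] : Prop where
  exists_transcendental_finite : ∃ x : K, Transcendental F x ∧ FiniteDimensional F⟮x⟯ K
  constants : ∀ z : K, IsAlgebraic F z → z ∈ (algebraMap F K).range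

/-- A closed point of the nonsingular projective curve with function field `K / F`, given by its
local ring: a discrete valuation ring of `K` that contains the constants `F`. -/
@[ext]
structure Place (F K : Type*) [Field F] [Field K] [Algebra F K] where
  /-- the local ring of the point -/
  ring : ValuationSubring K
  algebraMap_mem : ∀ c : F, algebraMap F K c ∈ ring
  isDVR : IsDiscreteValuationRing ring

/-- A divisor: a finite formal `ℤ`-linear combination of closed points. -/
abbrev Divisor (F K : Type*) [Field F] [Field K] [Algebra F K] := Place F K →₀ ℤ

section

variable {F K : Type*} [Field F] [Field K] [Algebra F K]

instance (P : Place F K) : IsDiscreteValuationRing P.ring := P.isDVR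

/-- The constants, as elements of the local ring. -/
def Place.constants (P : Place F K) : F →+* P.ring :=
  (algebraMap F K).codRestrict P.ring.toSubring P.algebraMap_mem

/-- A point is rational if its residue field is the field of constants `F` (degree one). -/
def Place.IsRational (P : Place F K) : Prop :=
  Function.Bijective ((IsLocalRing.residue P.ring).comp P.constants)

/-- The normalized discrete valuation `v_P : Kˣ → ℤ` (with the junk value `0` at `0`). -/
def Place.ord (P : Place F K) (h : K) : ℤ :=
  -WithZero.log ((IsDiscreteValuationRing.maximalIdeal P.ring).valuation K h)

/-- The coefficients of the divisor of poles of a nonzero function `h`. -/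
def poleDivisor (h : K) (P : Place F K) : ℤ := max 0 (-P.ord h)

variable {m : ℕ}

/-- The divisor `D_γ = γ₁ Q₁ + ⋯ + γ_m Q_m`. -/
def divisorOf (Q : Fin m → Place F K) (γ : Fin m → ℤ) : Divisor F K :=
  ∑ i, Finsupp.single (Q i) (γ i)

/-- `ℕ₀^m` as a subset of `ℤ^m`. -/
def natTuples (m : ℕ) : Set (Fin m → ℤ) := {α | ∀ i, 0 ≤ α i}

/-- The classical Weierstrass semigroup `H(Q)`: the tuples `α ∈ ℕ₀^m` such that some nonzero
function has divisor of poles exactly `∑ αᵢ Qᵢ`. -/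
def weierstrassSemigroup (Q : Fin m → Place F K) : Set (Fin m → ℤ) :=
  {α | α ∈ natTuples m ∧ ∃ h : K, h ≠ 0 ∧ ∀ P, poleDivisor h P = divisorOf Q α P}

/-- The set `G(Q) = ℕ₀^m \ H(Q)` of Weierstrass gaps. -/
def gaps (Q : Fin m → Place F K) : Set (Fin m → ℤ) :=
  natTuples m \ weierstrassSemigroup Q

/-- The functions that are regular outside `{Q₁, …, Q_m}`. -/
def regularOutside (Q : Fin m → Place F K) : Set K :=
  {h | ∀ P : Place F K, P ∉ Set.range Q → h ∈ P.ring}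

/-- The generalized Weierstrass semigroup `Ĥ(Q)`. -/
def genWeierstrassSemigroup (Q : Fin m → Place F K) : Set (Fin m → ℤ) :=
  {α | ∃ h ∈ regularOutside Q, h ≠ 0 ∧ ∀ i, α i = -(Q i).ord h}

/-- `∇̄_J(α)`. -/
def nablaBarOn (J : Finset (Fin m)) (α : Fin m → ℤ) : Set (Fin m → ℤ) :=
  {β | (∀ j ∈ J, β j = α j) ∧ ∀ i, i ∉ J → β i < α i}

/-- `∇_J(α) = ∇̄_J(α) ∩ Ĥ(Q)`. -/
def nablaOn (Q : Fin m → Place F K) (J : Finset (Fin m)) (α : Fin m → ℤ) : Set (Fin m → ℤ) :=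
  nablaBarOn J α ∩ genWeierstrassSemigroup Q

/-- `∇̄(α)`, the union of the `∇̄_{i}(α)`. -/
def nablaBar (α : Fin m → ℤ) : Set (Fin m → ℤ) := ⋃ i, nablaBarOn {i} α

/-- `∇(α) = ∇̄(α) ∩ Ĥ(Q)`. -/
def nabla (Q : Fin m → Place F K) (α : Fin m → ℤ) : Set (Fin m → ℤ) :=
  nablaBar α ∩ genWeierstrassSemigroup Q

/-- `α` is a maximal element of `Ĥ(Q)`. -/
def IsMaximal (Q : Fin m → Place F K) (α : Fin m → ℤ) : Prop :=
  α ∈ genWeierstrassSemigroup Q ∧ nabla Q α = ∅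

/-- `α` is a relative maximal element of `Ĥ(Q)`: it is maximal, and `∇_J(α) ≠ ∅` for every proper
subset `J` of the index set with at least two elements. -/
def IsRelativeMaximal (Q : Fin m → Place F K) (α : Fin m → ℤ) : Prop :=
  IsMaximal Q α ∧ ∀ J : Finset (Fin m), J ⊂ Finset.univ → 2 ≤ J.card → nablaOn Q J α ≠ ∅

/-- `Λ̂(Q)`, the set of relative maximal elements of `Ĥ(Q)`. -/
def relMaximals (Q : Fin m → Place F K) : Set (Fin m → ℤ) := {α | IsRelativeMaximal Q α}

/-- `Λ(Q) = Λ̂(Q) ∩ ℕ₀^m`. -/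
def natRelMaximals (Q : Fin m → Place F K) : Set (Fin m → ℤ) := relMaximals Q ∩ natTuples m

end

end AlgCurve

end

/-!
The inclusion `⊇` is elementary: if `β` is maximal with nonnegative coordinates, a function whose
pole divisor is a nonnegative point of `∇̄(β)` has its vector of pole orders in `∇(β)`,
or else a constant function does (`mem_gaps_of_mem_nablaBar`).

For `⊆`, let `γ` be a gap. A vector space over `F` is not covered by `m ≤ |F|` hyperplanes, so for
some `i` no function in `L(D_γ)` has pole order exactly `γᵢ` at `Qᵢ`
(`mem_genWeierstrassSemigroup_of_forall_exists`). Let `δ ≥ γ` with `δᵢ = γᵢ` be maximal with the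
same property (`exists_maximal_of_forall_val_ne`). For each `j ≠ i` there is then `fⱼ ∈ L(D_δ + Qⱼ)`
with pole order exactly `γᵢ` at `Qᵢ` and `δⱼ + 1` at `Qⱼ`. The tuple `β` with `βᵢ = γᵢ` and
`βⱼ = δⱼ + 1` for `j ≠ i` is relative maximal, and `γ ∈ ∇̄ᵢ(β)`: linear combinations of the `fⱼ`
with nonzero coefficients have poles of exact order `βⱼ` at the chosen `Qⱼ`, and, with the `fⱼ`
normalized at `Qᵢ`, the pole of order `γᵢ` there is kept or lowered according to whether the sum of
the coefficients vanishes; fewer than `|F|` nonzero coefficients (at least two, for a vanishing sum)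
can be chosen either way. A function violating the maximality of `β` could be used to cancel
the pole of some `fⱼ` at `Qⱼ`, against the choice of `δ`
(`exists_natRelMaximals_of_forall_val_ne`).

That a maximal `δ` exists is the only point where the geometry of the curve enters: for rational
points `P ≠ R` and `n ≥ 0` there must be a function with pole order exactly `n` at `P` and no
pole outside `{P, R}` (`Place.IsRational.exists_two_poles`). The Riemann-Roch theorem is not needed
for this. Let `x` have a pole at `P`, with `K` finite over `F(x)`. A basis of `K` over `F(x)` that
is integral over `F[x]`, together with division with remainder in `F[x]`, shows that every function
is the sum of one that is regular wherever `x` is and one with bounded poles at the poles of `x`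
(`exists_approximation`). There are finitely many poles of `x` (`finite_poles`), so by weak
approximation some function `b_N` has pole order `N` at `P` for each large `N`, bounded
poles at the other poles of `x`, and no further poles. Since `F` is finite, the polar parts away
from `P` take finitely many values (`exists_finite_representatives`), so for all large `N`
a difference `b_N - b_N'` with `N' < N` has `P` as its only pole
(`Place.IsRational.exists_only_pole`). Multiplying by powers of a function with a zero at `P` and
a pole only at `R` reaches the small orders.
-/

open scoped IntermediateField

noncomputable section

namespace AlgCurve

open WithZero WithZeroMulInt Polynomial

/-! ### The valuation of a place -/

section Valuation

variable {F K : Type*} [Field F] [Field K] [Algebra F K]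

/-- The normalized valuation of a place, written multiplicatively: `P.val h = exp (-v_P(h))`. -/
def Place.val (P : Place F K) : Valuation K (WithZero (Multiplicative ℤ)) :=
  (IsDiscreteValuationRing.maximalIdeal P.ring).valuation K

theorem Place.val_le_one_iff (P : Place F K) {f : K} : P.val f ≤ 1 ↔ f ∈ P.ring := by
  constructor
  · intro h
    obtain ⟨a, rfl⟩ := IsDiscreteValuationRing.exists_lift_of_le_one (A := P.ring) h
    exact a.2
  · intro h
    exact (IsDiscreteValuationRing.maximalIdeal P.ring).valuation_le_one (K := K) ⟨f, h⟩

theorem Place.one_lt_val_iff (P : Place F K) {f : K} : 1 < P.val f ↔ f ∉ P.ring := by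
  rw [← P.val_le_one_iff, not_le]

theorem Place.neg_ord_eq (P : Place F K) (f : K) : -P.ord f = log (P.val f) := by
  simp [Place.ord, Place.val]

theorem Place.eq_neg_ord_iff (P : Place F K) {f : K} (hf : f ≠ 0) (n : ℤ) :
    n = -P.ord f ↔ P.val f = exp n := by
  rw [P.neg_ord_eq]
  have : P.val f ≠ 0 := by simpa using hf
  constructor
  · rintro rfl
    exact (exp_log this).symm
  · intro h
    rw [h, log_exp]

theorem Place.val_algebraMap (P : Place F K) {c : F} (hc : c ≠ 0) :
    P.val (algebraMap F K c) = 1 := by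
  have h : ∀ c : F, P.val (algebraMap F K c) ≤ 1 := fun c ↦
    P.val_le_one_iff.2 (P.algebraMap_mem c)
  refine le_antisymm (h c) ?_
  have h2 := h c⁻¹
  rw [map_inv₀, map_inv₀] at h2
  have h3 : P.val (algebraMap F K c) ≠ 0 := by simpa using hc
  exact (inv_le_one₀ (zero_lt_iff.2 h3)).1 h2

theorem Place.val_algebraMap_le (P : Place F K) (c : F) : P.val (algebraMap F K c) ≤ 1 :=
  P.val_le_one_iff.2 (P.algebraMap_mem c)

theorem Place.val_smul_le (P : Place F K) (c : F) (f : K) : P.val (c • f) ≤ P.val f := by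
  rw [Algebra.smul_def, map_mul]
  exact mul_le_of_le_one_left' (P.val_algebraMap_le c)

theorem Place.val_smul (P : Place F K) {c : F} (hc : c ≠ 0) (f : K) : P.val (c • f) = P.val f := by
  rw [Algebra.smul_def, map_mul, P.val_algebraMap hc, one_mul]

theorem Place.exists_val_eq (P : Place F K) (n : ℤ) : ∃ f : K, P.val f = exp n := by
  obtain ⟨π, hπ⟩ :=
    (IsDiscreteValuationRing.maximalIdeal P.ring).valuation_exists_uniformizer K
  refine ⟨π ^ (-n), ?_⟩
  rw [map_zpow₀]
  change (IsDiscreteValuationRing.maximalIdeal P.ring).valuation K π ^ (-n) = _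
  rw [hπ, ← exp_zsmul]
  simp

theorem Place.ne_zero_of_val_eq_exp (P : Place F K) {f : K} {n : ℤ} (h : P.val f = exp n) :
    f ≠ 0 := by
  rintro rfl
  rw [map_zero] at h
  exact exp_ne_zero h.symm

/-- At a rational point every regular function takes a value in the constants. -/
theorem Place.IsRational.exists_value {P : Place F K} (hP : P.IsRational) {f : K}
    (hf : P.val f ≤ 1) : ∃ c : F, P.val (f - algebraMap F K c) < 1 := by
  have hf' := P.val_le_one_iff.1 hf
  obtain ⟨c, hc⟩ := hP.2 (IsLocalRing.residue P.ring ⟨f, hf'⟩)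
  refine ⟨c, ?_⟩
  have h1 : IsLocalRing.residue P.ring (⟨f, hf'⟩ - P.constants c) = 0 := by
    rw [map_sub, sub_eq_zero, ← hc]; rfl
  rw [IsLocalRing.residue_eq_zero_iff] at h1
  exact ((IsDiscreteValuationRing.maximalIdeal P.ring).valuation_lt_one_iff_mem (K := K) _).2 h1

/-- Weak approximation: a function with a pole at one and zeros at the other
members of a finite family of places. -/
theorem Place.exists_one_lt_lt_one {ι : Type*} [Finite ι] (S : ι → Place F K)
    (hS : Function.Injective S) (i : ι) :
    ∃ a : K, 1 < (S i).val a ∧ ∀ j ≠ i, (S j).val a < 1 := by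
  have hb : (1 : NNReal) < 2 := by norm_num
  let v : ι → AbsoluteValue K ℝ := fun i ↦
    (IsDiscreteValuationRing.maximalIdeal (S i).ring).adicAbv hb
  let φ := toNNReal (ne_zero_of_lt hb)
  have hφ : StrictMono φ := toNNReal_strictMono hb
  have lt_iff : ∀ i f, v i f < 1 ↔ (S i).val f < 1 := fun i f ↦ by
    change ((φ ((S i).val f) : NNReal) : ℝ) < (1 : NNReal) ↔ _
    rw [NNReal.coe_lt_coe, ← hφ.lt_iff_lt, map_one]
  have le_iff : ∀ i f, 1 < v i f ↔ 1 < (S i).val f := fun i f ↦ by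
    change ((1 : NNReal) : ℝ) < (φ ((S i).val f) : NNReal) ↔ _
    rw [NNReal.coe_lt_coe, ← hφ.lt_iff_lt, map_one]
  obtain ⟨a, ha, ha'⟩ := AbsoluteValue.exists_one_lt_lt_one_pi_of_not_isEquiv (v := v)
    (fun i ↦ by
      obtain ⟨f, hf⟩ := (S i).exists_val_eq 1
      refine ⟨f, (S i).ne_zero_of_val_eq_exp hf, ?_⟩
      have : 1 < v i f := by rw [le_iff, hf, ← exp_zero, exp_lt_exp]; norm_num
      exact this.ne')
    (fun i j hij h ↦ hij (hS (Place.ext (by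
      ext f
      rw [← not_iff_not, ← (S i).one_lt_val_iff, ← (S j).one_lt_val_iff, ← le_iff, ← le_iff]
      exact h.one_lt_iff)))) i
  exact ⟨a, (le_iff _ _).1 ha, fun j hj ↦ (lt_iff _ _).1 (ha' j hj)⟩

end Valuation

/-! ### Functions with bounded poles at the poles of a given function -/

section PoleBounded

variable {F K : Type*} [Field F] [Field K] [Algebra F K]

theorem Place.val_eq_one_of_sub_le (S : Place F K) {x f : K} (hS : 1 < S.val x) {c : F} (hc : c ≠ 0)
    (h : S.val (f - algebraMap F K c) ≤ (S.val x)⁻¹) : S.val f = 1 := by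
  rw [← S.val_algebraMap hc]
  refine Valuation.map_eq_of_sub_lt _ (h.trans_lt ?_)
  rw [S.val_algebraMap hc]
  exact inv_lt_one_of_one_lt₀ hS

/-- A polynomial of degree `d` in `x` is `c * x ^ d` to first order at each pole of `x`. -/
theorem Place.val_aeval_mul_zpow_sub_le (x : K) (p : F[X]) (S : Place F K) (hS : 1 < S.val x) :
    S.val (aeval x p * x ^ (-(p.natDegree : ℤ)) - algebraMap F K p.leadingCoeff) ≤
      (S.val x)⁻¹ := by
  have hv : S.val x ≠ 0 := (zero_lt_one.trans hS).ne'
  have hx : x ≠ 0 := by rintro rfl; simp at hv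
  rw [aeval_eq_sum_range, Finset.sum_range_succ, add_mul]
  have : p.coeff p.natDegree • x ^ p.natDegree * x ^ (-(p.natDegree : ℤ)) =
      algebraMap F K p.leadingCoeff := by
    rw [zpow_neg, zpow_natCast, Algebra.smul_def, mul_assoc, mul_inv_cancel₀ (pow_ne_zero _ hx),
      mul_one]
    rfl
  rw [this, add_sub_cancel_right, Finset.sum_mul]
  refine Valuation.map_sum_le _ fun k hk ↦ ?_
  rw [smul_mul_assoc]
  refine (S.val_smul_le _ _).trans ?_
  rw [← zpow_natCast, ← zpow_add₀ hx, map_zpow₀, ← zpow_neg_one]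
  refine zpow_le_zpow_right₀ hS.le ?_
  have := Finset.mem_range.1 hk
  omega

/-- A rational function of `x` is `c * x ^ d` to first order at each pole of `x`, for a degree `d`
and a leading coefficient `c` that do not depend on the pole. -/
theorem exists_leading_coeff (x a : K) (ha : a ∈ F⟮x⟯) (ha0 : a ≠ 0) :
    ∃ (d : ℤ) (c : F), c ≠ 0 ∧ ∀ S : Place F K, 1 < S.val x →
      S.val (a * x ^ (-d) - algebraMap F K c) ≤ (S.val x)⁻¹ := by
  obtain ⟨p, q, rfl⟩ := (IntermediateField.mem_adjoin_simple_iff F a).1 ha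
  have hp : p ≠ 0 := by rintro rfl; simp at ha0
  have hq : q ≠ 0 := by rintro rfl; simp at ha0
  have hc' : q.leadingCoeff ≠ 0 := leadingCoeff_ne_zero.2 hq
  refine ⟨p.natDegree - q.natDegree, p.leadingCoeff / q.leadingCoeff,
    div_ne_zero (leadingCoeff_ne_zero.2 hp) hc', fun S hS ↦ ?_⟩
  have hv : S.val x ≠ 0 := (zero_lt_one.trans hS).ne'
  have hx : x ≠ 0 := by rintro rfl; simp at hv
  have h1 := S.val_aeval_mul_zpow_sub_le x p hS
  have h2 := S.val_aeval_mul_zpow_sub_le x q hS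
  have hB : S.val (aeval x q * x ^ (-(q.natDegree : ℤ))) = 1 :=
    S.val_eq_one_of_sub_le hS hc' h2
  have hA : aeval x p / aeval x q * x ^ (-((p.natDegree : ℤ) - q.natDegree)) =
      (aeval x p * x ^ (-(p.natDegree : ℤ))) / (aeval x q * x ^ (-(q.natDegree : ℤ))) := by
    rw [mul_div_mul_comm, ← zpow_sub₀ hx]
    congr 2
    ring
  rw [hA]
  set A := aeval x p * x ^ (-(p.natDegree : ℤ))
  set B := aeval x q * x ^ (-(q.natDegree : ℤ))
  have hB0 : B ≠ 0 := by intro h; rw [h, map_zero] at hB; exact zero_ne_one hB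
  have hc'' : algebraMap F K q.leadingCoeff ≠ 0 := by simpa using hq
  have : A / B - algebraMap F K (p.leadingCoeff / q.leadingCoeff) =
      (algebraMap F K q.leadingCoeff * (A - algebraMap F K p.leadingCoeff) -
        algebraMap F K p.leadingCoeff * (B - algebraMap F K q.leadingCoeff)) /
      (algebraMap F K q.leadingCoeff * B) := by
    rw [map_div₀]
    field_simp
    ring
  rw [this, map_div₀, map_mul _ _ B, hB, S.val_algebraMap hc', mul_one, div_one]
  refine Valuation.map_sub_le _ ?_ ?_
  · rw [map_mul, S.val_algebraMap hc', one_mul]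
    exact h1
  · rw [map_mul]
    exact (mul_le_of_le_one_left' (S.val_algebraMap_le _)).trans h2

/-- A finite family of rational functions of `x`, not all zero, can be rescaled by a power of `x`
so that it has constant values, not all zero, common to all the poles of `x`. -/
theorem exists_leading_coeffs {ι : Type*} [Finite ι] (x : K) (a : ι → K) (ha : ∀ i, a i ∈ F⟮x⟯)
    (ha0 : ∃ i, a i ≠ 0) :
    ∃ (d : ℤ) (c : ι → F), c ≠ 0 ∧ ∀ i (S : Place F K), 1 < S.val x →
      S.val (a i * x ^ (-d) - algebraMap F K (c i)) ≤ (S.val x)⁻¹ := by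
  classical
  have key : ∀ i, ∃ (d : ℤ) (c : F), a i ≠ 0 → c ≠ 0 ∧ ∀ S : Place F K, 1 < S.val x →
      S.val (a i * x ^ (-d) - algebraMap F K c) ≤ (S.val x)⁻¹ := fun i ↦ by
    by_cases h : a i = 0
    · exact ⟨0, 0, fun h' ↦ (h' h).elim⟩
    · obtain ⟨d, c, h'⟩ := exists_leading_coeff x (a i) (ha i) h
      exact ⟨d, c, fun _ ↦ h'⟩
  choose d c hdc using key
  have := Fintype.ofFinite ι
  obtain ⟨i₀, hi₀, hmax⟩ := Finset.exists_max_image (Finset.univ.filter fun i ↦ a i ≠ 0) d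
    (by simpa [Finset.Nonempty] using ha0)
  have hi₀ : a i₀ ≠ 0 := by simpa using hi₀
  refine ⟨d i₀, fun i ↦ if a i ≠ 0 ∧ d i = d i₀ then c i else 0, fun h ↦ (hdc i₀ hi₀).1 ?_,
    fun i S hS ↦ ?_⟩
  · have := congrFun h i₀
    rwa [if_pos ⟨hi₀, rfl⟩] at this
  · have hv : S.val x ≠ 0 := (zero_lt_one.trans hS).ne'
    have hx : x ≠ 0 := by rintro rfl; simp at hv
    dsimp only
    by_cases h0 : a i = 0
    · simp [h0]
    by_cases h1 : d i = d i₀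
    · rw [if_pos ⟨h0, h1⟩, ← h1]
      exact (hdc i h0).2 S hS
    · rw [if_neg fun h ↦ h1 h.2, map_zero, sub_zero]
      have h3 := S.val_eq_one_of_sub_le hS (hdc i h0).1 ((hdc i h0).2 S hS)
      have h4 : a i * x ^ (-d i₀) = a i * x ^ (-d i) * x ^ (d i - d i₀) := by
        rw [mul_assoc, ← zpow_add₀ hx]
        congr 2
        ring
      rw [h4, map_mul, h3, one_mul, map_zpow₀, ← zpow_neg_one]
      refine zpow_le_zpow_right₀ hS.le ?_
      have := lt_of_le_of_ne (hmax i (by simpa using h0)) h1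
      omega

/-- A function has only finitely many poles: given finitely many poles of `x`, functions each having
a pole at one of them and zeros at the others are linearly independent over `F(x)`. -/
theorem finite_poles (x : K) [FiniteDimensional F⟮x⟯ K] :
    {S : Place F K | 1 < S.val x}.Finite := by
  classical
  by_contra hinf
  obtain ⟨T, hT, hcard⟩ := Set.Infinite.exists_subset_card_eq hinf (Module.finrank F⟮x⟯ K + 1)
  choose z hz hz' using Place.exists_one_lt_lt_one (fun S : T ↦ (S : Place F K))
    Subtype.val_injective
  have hli : LinearIndependent F⟮x⟯ z := by
    rw [Fintype.linearIndependent_iff]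
    by_contra! h
    obtain ⟨a, hsum, ha⟩ := h
    obtain ⟨d, c, hc, hdc⟩ := exists_leading_coeffs x (fun i ↦ (a i : K)) (fun i ↦ (a i).2)
      (by simpa using ha)
    obtain ⟨S, hcS⟩ := Function.ne_iff.1 hc
    have hS : 1 < (S : Place F K).val x := hT S.2
    have hsum' : ∑ i, (a i : K) * x ^ (-d) * z i = 0 := by
      have := congrArg (fun t ↦ x ^ (-d) * t) hsum
      simp only [Finset.mul_sum, mul_zero] at this
      rw [← this]
      refine Finset.sum_congr rfl fun i _ ↦ ?_
      rw [Algebra.smul_def, ← mul_assoc, mul_comm (x ^ (-d))]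
      rfl
    have hinv := inv_lt_one_of_one_lt₀ hS
    have h1 : (S : Place F K).val ((a S : K) * x ^ (-d)) = 1 :=
      (S : Place F K).val_eq_one_of_sub_le hS hcS (hdc S S hS)
    have h2 : ∀ i, (S : Place F K).val ((a i : K) * x ^ (-d)) ≤ 1 := fun i ↦ by
      have := Valuation.map_add_le _ ((hdc i S hS).trans hinv.le)
        ((S : Place F K).val_algebraMap_le (c i))
      simpa using this
    rw [Fintype.sum_eq_add_sum_compl S, add_eq_zero_iff_eq_neg] at hsum'
    have h3 := congrArg (S : Place F K).val hsum'
    rw [Valuation.map_neg, map_mul, h1, one_mul] at h3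
    refine (hz S).not_ge (h3.le.trans (Valuation.map_sum_le _ fun i hi ↦ ?_))
    rw [map_mul]
    refine mul_le_one' (h2 i) (hz' i S ?_).le
    rintro rfl
    simp at hi
  have := hli.fintype_card_le_finrank
  simp [hcard] at this

/-- The functions whose order at each pole of `x` is at least that of `x ^ n`. -/
def poleBounded (x : K) (n : ℤ) : Submodule F K where
  carrier := {f | ∀ S : Place F K, 1 < S.val x → S.val f ≤ S.val x ^ n}
  add_mem' hf hg S hS := Valuation.map_add_le _ (hf S hS) (hg S hS)
  zero_mem' S hS := by simp
  smul_mem' c f hf S hS := (S.val_smul_le c f).trans (hf S hS)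

theorem poleBounded_mono (x : K) {n k : ℤ} (h : n ≤ k) :
    poleBounded (F := F) x n ≤ poleBounded x k := fun _ hf S hS ↦
  (hf S hS).trans (zpow_le_zpow_right₀ hS.le h)

theorem mul_mem_poleBounded {x f g : K} {n k : ℤ} (hf : f ∈ poleBounded (F := F) x n)
    (hg : g ∈ poleBounded (F := F) x k) : f * g ∈ poleBounded (F := F) x (n + k) := fun S hS ↦ by
  rw [map_mul, zpow_add₀ (zero_lt_one.trans hS).ne']
  exact mul_le_mul' (hf S hS) (hg S hS)

theorem zpow_mem_poleBounded (x : K) (n : ℤ) : x ^ n ∈ poleBounded (F := F) x n := fun S _ ↦ by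
  rw [map_zpow₀]

/-- The functions regular at the poles of `x` form a finite set modulo those that vanish there
at least to the order of `1 / x`: a family that is linearly independent over `F` modulo
the latter is linearly independent over `F(x)`. -/
theorem finite_quotient_poleBounded [Finite F] (x : K) [FiniteDimensional F⟮x⟯ K] :
    Finite (poleBounded (F := F) x 0 ⧸
      (poleBounded (F := F) x (-1)).comap (poleBounded x 0).subtype) := by
  have hrank : Module.rank F (poleBounded (F := F) x 0 ⧸
      (poleBounded (F := F) x (-1)).comap (poleBounded x 0).subtype) ≤
      (Module.finrank F⟮x⟯ K : ℕ) := by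
    refine rank_le fun s hs ↦ ?_
    choose z hz using fun i : s ↦ Submodule.Quotient.mk_surjective _ i.1
    have hli : LinearIndependent F⟮x⟯ (fun i : s ↦ (z i : K)) := by
      rw [Fintype.linearIndependent_iff]
      by_contra! h
      obtain ⟨a, hsum, ha⟩ := h
      obtain ⟨d, c, hc, hdc⟩ := exists_leading_coeffs (F := F) x (fun i ↦ (a i : K))
        (fun i ↦ (a i).2) (by simpa using ha)
      refine hc (funext (Fintype.linearIndependent_iff.1 hs c ?_))
      simp_rw [← hz, ← Submodule.Quotient.mk_smul]
      change ∑ i, Submodule.mkQ _ (c i • z i) = 0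
      rw [← map_sum, Submodule.mkQ_apply, Submodule.Quotient.mk_eq_zero, Submodule.mem_comap]
      have hsum' : ∑ i, (a i : K) * x ^ (-d) * (z i : K) = 0 := by
        have := congrArg (fun t ↦ x ^ (-d) * t) hsum
        simp only [Finset.mul_sum, mul_zero] at this
        rw [← this]
        refine Finset.sum_congr rfl fun i _ ↦ ?_
        rw [Algebra.smul_def, ← mul_assoc, mul_comm (x ^ (-d))]
        rfl
      have h1 : (poleBounded (F := F) x 0).subtype (∑ i, c i • z i) =
          -∑ i, ((a i : K) * x ^ (-d) - algebraMap F K (c i)) * (z i : K) := by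
        simp only [sub_mul, Finset.sum_sub_distrib, hsum', zero_sub, neg_neg, map_sum]
        refine Finset.sum_congr rfl fun i _ ↦ ?_
        rw [map_smul, Algebra.smul_def]
        rfl
      rw [h1]
      refine neg_mem (sum_mem fun i _ ↦ ?_)
      rw [← add_zero (-1 : ℤ)]
      refine mul_mem_poleBounded (fun S hS ↦ ?_) (z i).2
      rw [zpow_neg_one]
      exact hdc i S hS
    simpa using hli.fintype_card_le_finrank
  have : Module.Finite F (poleBounded (F := F) x 0 ⧸
      (poleBounded (F := F) x (-1)).comap (poleBounded x 0).subtype) :=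
    Module.rank_lt_aleph0_iff.1 (hrank.trans_lt Cardinal.natCast_lt_aleph0)
  exact Module.finite_of_finite F

/-- The functions regular at the poles of `x` have finitely many classes modulo those that vanish
there at least to the order of `x ^ (-k)`. -/
theorem exists_finite_representatives [Finite F] (x : K) (hx : x ≠ 0) [FiniteDimensional F⟮x⟯ K]
    (k : ℕ) : ∃ Z : Set K, Z.Finite ∧ ∀ f ∈ poleBounded (F := F) x 0,
      ∃ z ∈ Z, f - z ∈ poleBounded (F := F) x (-k) := by
  induction k with
  | zero => exact ⟨{0}, Set.finite_singleton 0, fun f hf ↦ ⟨0, rfl, by simpa using hf⟩⟩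
  | succ k ih =>
    obtain ⟨Z, hZ, hZf⟩ := ih
    have := finite_quotient_poleBounded (F := F) x
    let Z₁ : Set K := Set.range fun i : poleBounded (F := F) x 0 ⧸
      (poleBounded (F := F) x (-1)).comap (poleBounded x 0).subtype ↦ (i.out : K)
    refine ⟨Set.image2 (fun z w ↦ z + x ^ (-1 : ℤ) * w) Z₁ Z,
      (Set.finite_range _).image2 _ hZ, fun f hf ↦ ?_⟩
    let i := Submodule.Quotient.mk (p := (poleBounded (F := F) x (-1)).comap
      (poleBounded x 0).subtype) ⟨f, hf⟩
    have h1 : f - (i.out : K) ∈ poleBounded (F := F) x (-1) :=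
      (Submodule.Quotient.eq ((poleBounded (F := F) x (-1)).comap
        (poleBounded x 0).subtype)).1 (Quotient.out_eq i).symm
    have h2 := mul_mem_poleBounded (zpow_mem_poleBounded (F := F) x 1) h1
    obtain ⟨w, hw, hfw⟩ := hZf _ h2
    refine ⟨_, ⟨_, ⟨i, rfl⟩, w, hw, rfl⟩, ?_⟩
    have h3 := mul_mem_poleBounded (zpow_mem_poleBounded (F := F) x (-1)) hfw
    convert h3 using 1
    · congr 1
      push_cast
      ring
    · rw [mul_sub (x ^ (-1 : ℤ)), ← mul_assoc, ← zpow_add₀ hx]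
      simp [sub_sub]

end PoleBounded

/-! ### Existence of functions with prescribed poles -/

section StrongApproximation

variable {F K : Type*} [Field F] [Field K] [Algebra F K]

theorem exists_mem_poleBounded (x : K) [FiniteDimensional F⟮x⟯ K] (u : K) :
    ∃ n : ℕ, u ∈ poleBounded (F := F) x n := by
  have hfin := finite_poles (F := F) x
  have : ∀ S : Place F K, ∃ n : ℕ, 1 < S.val x → S.val u ≤ S.val x ^ n := fun S ↦ by
    by_cases hS : 1 < S.val x
    · obtain ⟨n, hn⟩ := MulArchimedean.arch (S.val u) hS
      exact ⟨n, fun _ ↦ hn⟩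
    · exact ⟨0, fun h ↦ (hS h).elim⟩
  choose n hn using this
  refine ⟨hfin.toFinset.sup n, fun S hS ↦ (hn S hS).trans ?_⟩
  rw [zpow_natCast]
  exact pow_le_pow_right₀ hS.le (Finset.le_sup (hfin.mem_toFinset.2 hS))

/-- A function integral over `F[x]` is regular wherever `x` is. -/
theorem Place.val_le_one_of_isIntegral (S : Place F K) {x u : K} (hS : S.val x ≤ 1)
    (hu : IsIntegral (Algebra.adjoin F {x}) u) : S.val u ≤ 1 := by
  have hmem : ∀ a ∈ Algebra.adjoin F {x}, a ∈ S.ring := fun a ha ↦ by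
    induction ha using Algebra.adjoin_induction with
    | mem y hy =>
      rw [Set.mem_singleton_iff.1 hy]
      exact S.val_le_one_iff.1 hS
    | algebraMap r => exact S.algebraMap_mem r
    | add _ _ _ _ h1 h2 => exact add_mem h1 h2
    | mul _ _ _ _ h1 h2 => exact mul_mem h1 h2
  let φ : Algebra.adjoin F {x} →+* S.ring :=
    (algebraMap (Algebra.adjoin F {x}) K).codRestrict S.ring.toSubring fun a ↦ hmem a a.2
  obtain ⟨p, hp, hpu⟩ := hu
  have hint : IsIntegral S.ring u := by
    refine ⟨p.map φ, hp.map φ, ?_⟩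
    rw [eval₂_map]
    exact hpu
  obtain ⟨y, rfl⟩ := IsIntegrallyClosed.isIntegral_iff.1 hint
  exact S.val_le_one_iff.2 y.2

/-- A rational function of `x` is a polynomial in `x` plus a function regular at the poles
of `x`, by division with remainder. -/
theorem exists_polynomial_add (x a : K) (ha : a ∈ F⟮x⟯) :
    ∃ p : F[X], a - aeval x p ∈ poleBounded (F := F) x 0 := by
  obtain ⟨p, q, rfl⟩ := (IntermediateField.mem_adjoin_simple_iff F a).1 ha
  by_cases hq : aeval x q = 0
  · exact ⟨0, by simp [hq]⟩
  have hq0 : q ≠ 0 := by rintro rfl; simp at hq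
  refine ⟨p / q, fun S hS ↦ ?_⟩
  have hv : S.val x ≠ 0 := (zero_lt_one.trans hS).ne'
  have hx : x ≠ 0 := by rintro rfl; simp at hv
  have h1 : aeval x p / aeval x q - aeval x (p / q) = aeval x (p % q) / aeval x q := by
    rw [EuclideanDomain.mod_eq_sub_mul_div, map_sub, map_mul]
    field_simp
  by_cases hr : p % q = 0
  · rw [h1, hr]
    simp
  have hval : ∀ r : F[X], r ≠ 0 → S.val (aeval x r) = S.val x ^ r.natDegree := fun r hr ↦ by
    have h2 := S.val_eq_one_of_sub_le hS (leadingCoeff_ne_zero.2 hr)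
      (S.val_aeval_mul_zpow_sub_le x r hS)
    rw [map_mul, map_zpow₀, zpow_neg, zpow_natCast] at h2
    exact eq_of_div_eq_one (by rwa [div_eq_mul_inv])
  rw [h1, map_div₀, hval _ hr, hval _ hq0, zpow_zero]
  refine div_le_one_of_le₀ (pow_le_pow_right₀ hS.le ?_) zero_le
  exact natDegree_le_natDegree (EuclideanDomain.mod_lt p hq0).le

open scoped IntermediateField.algebraAdjoinAdjoin in
/-- Every function is, up to an error with bounded poles at the poles of `x`, a function
regular wherever `x` is regular. -/
theorem exists_approximation (x : K) [FiniteDimensional F⟮x⟯ K] :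
    ∃ n : ℕ, ∀ g : K, ∃ b : K, (∀ S : Place F K, S.val x ≤ 1 → S.val b ≤ 1) ∧
      g - b ∈ poleBounded (F := F) x n := by
  let v := Module.finBasis F⟮x⟯ K
  have : ∀ i, ∃ y : Algebra.adjoin F {x}, y ≠ 0 ∧ IsIntegral (Algebra.adjoin F {x}) (y • v i) :=
    fun i ↦ ((IsFractionRing.isAlgebraic_iff (Algebra.adjoin F {x}) F⟮x⟯ K).2
      (Algebra.IsAlgebraic.isAlgebraic (v i))).exists_integral_multiple
  choose y hy hyv using this
  have hy' : ∀ i, (y i : K) ≠ 0 := fun i ↦ by simpa using hy i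
  choose n hn using fun i ↦ exists_mem_poleBounded (F := F) x (y i • v i)
  refine ⟨Finset.univ.sup n, fun g ↦ ?_⟩
  have hmem : ∀ i, (v.repr g i : K) / y i ∈ F⟮x⟯ := fun i ↦
    div_mem (v.repr g i).2 (IntermediateField.algebra_adjoin_le_adjoin F {x} (y i).2)
  choose p hp using fun i ↦ exists_polynomial_add x _ (hmem i)
  refine ⟨∑ i, aeval x (p i) * (y i • v i), fun S hS ↦ Valuation.map_sum_le _ fun i _ ↦ ?_, ?_⟩
  · rw [map_mul]
    refine mul_le_one' (S.val_le_one_of_isIntegral hS ?_) (S.val_le_one_of_isIntegral hS (hyv i))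
    have : aeval x (p i) ∈ Algebra.adjoin F {x} := aeval_mem_adjoin_singleton F x
    exact isIntegral_algebraMap (x := (⟨_, this⟩ : Algebra.adjoin F {x}))
  · have hg : g = ∑ i, (v.repr g i : K) / y i * (y i • v i) := by
      conv_lhs => rw [← v.sum_repr g]
      refine Finset.sum_congr rfl fun i _ ↦ ?_
      rw [Algebra.smul_def, Algebra.smul_def, ← mul_assoc]
      congr 1
      exact (div_mul_cancel₀ _ (hy' i)).symm
    have hsub : g - ∑ i, aeval x (p i) * (y i • v i) =
        ∑ i, ((v.repr g i : K) / y i - aeval x (p i)) * (y i • v i) := by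
      conv_lhs => rw [hg]
      simp only [sub_mul, Finset.sum_sub_distrib]
    rw [hsub]
    refine sum_mem fun i _ ↦ ?_
    refine poleBounded_mono x ?_ (mul_mem_poleBounded (hp i) (hn i))
    rw [zero_add]
    exact_mod_cast Finset.le_sup (Finset.mem_univ i)

/-- A prescribed order at one of the poles of `x`, and regularity at the others. -/
theorem exists_val_eq_and_le_one (x : K) [FiniteDimensional F⟮x⟯ K] (P : Place F K)
    (hP : 1 < P.val x) (n : ℤ) :
    ∃ g : K, P.val g = exp n ∧ ∀ S : Place F K, 1 < S.val x → S ≠ P → S.val g ≤ 1 := by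
  have hfin := finite_poles (F := F) x
  have : Finite {S : Place F K | 1 < S.val x} := hfin
  obtain ⟨a, ha, ha'⟩ := Place.exists_one_lt_lt_one
    (fun S : {S : Place F K | 1 < S.val x} ↦ (S : Place F K)) Subtype.val_injective ⟨P, hP⟩
  have ha0 : a ≠ 0 := by rintro rfl; simp at ha
  obtain ⟨u, hu⟩ := P.exists_val_eq n
  have : ∀ S : Place F K, ∃ k : ℕ, 1 < S.val x → S ≠ P → S.val u ≤ (S.val a)⁻¹ ^ k := fun S ↦ by
    by_cases hS : 1 < S.val x ∧ S ≠ P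
    · have h1 : 1 < (S.val a)⁻¹ := (one_lt_inv₀ (zero_lt_iff.2 (by simpa using ha0))).2
        (ha' ⟨S, hS.1⟩ fun h ↦ hS.2 (congrArg Subtype.val h))
      obtain ⟨k, hk⟩ := MulArchimedean.arch (S.val u) h1
      exact ⟨k, fun _ _ ↦ hk⟩
    · exact ⟨0, fun h1 h2 ↦ (hS ⟨h1, h2⟩).elim⟩
  choose k hk using this
  set N := hfin.toFinset.sup k + 1
  -- `a ^ N / (1 + a ^ N)` is close to `1` at `P` and close to `0` at the other poles.
  refine ⟨u * (a ^ N / (1 + a ^ N)), ?_, fun S hS hSP ↦ ?_⟩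
  · have h1 : P.val (1 + a ^ N) = P.val (a ^ N) := by
      refine Valuation.map_add_eq_of_lt_right _ ?_
      rw [map_one, map_pow]
      exact one_lt_pow₀ ha (by omega)
    rw [map_mul, map_div₀, h1, div_self (by simpa using ha0), mul_one, hu]
  · have h2 : S.val a < 1 := ha' ⟨S, hS⟩ fun h ↦ hSP (congrArg Subtype.val h)
    have h1 : S.val (1 + a ^ N) = 1 := by
      refine Valuation.map_one_add_of_lt _ ?_
      rw [map_pow]
      exact pow_lt_one₀ zero_le h2 (by omega)
    have h3 := hk S hS hSP
    have h4 : S.val a ^ N ≤ S.val a ^ k S := pow_le_pow_of_le_one zero_le h2.le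
      ((Finset.le_sup (hfin.mem_toFinset.2 hS)).trans (Nat.le_succ _))
    rw [map_mul, map_div₀, h1, div_one, map_pow]
    refine (mul_le_mul' h3 h4).trans (le_of_eq ?_)
    rw [← mul_pow, inv_mul_cancel₀ (by simpa using ha0), one_pow]

/-- A rational point is a pole of some `x` with `K` finite over `F(x)`. -/
theorem Place.IsRational.exists_pole [IsCurveFunctionField F K] {P : Place F K}
    (hP : P.IsRational) : ∃ x : K, 1 < P.val x ∧ FiniteDimensional F⟮x⟯ K := by
  obtain ⟨y, hy, hfin⟩ := IsCurveFunctionField.exists_transcendental_finite (F := F) (K := K)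
  by_cases h : 1 < P.val y
  · exact ⟨y, h, hfin⟩
  obtain ⟨c, hc⟩ := hP.exists_value (not_lt.1 h)
  have h0 : y - algebraMap F K c ≠ 0 := fun h0 ↦
    hy (by rw [sub_eq_zero.1 h0]; exact isAlgebraic_algebraMap c)
  refine ⟨(y - algebraMap F K c)⁻¹, ?_, ?_⟩
  · rw [map_inv₀]
    exact (one_lt_inv₀ (zero_lt_iff.2 (by simpa using h0))).2 hc
  · have : F⟮(y - algebraMap F K c)⁻¹⟯ = F⟮y⟯ := by
      refine le_antisymm ?_ ?_
      · rw [IntermediateField.adjoin_simple_le_iff]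
        exact inv_mem (sub_mem (IntermediateField.mem_adjoin_simple_self F y)
          (IntermediateField.algebraMap_mem _ c))
      · rw [IntermediateField.adjoin_simple_le_iff]
        have := add_mem (inv_mem (IntermediateField.mem_adjoin_simple_self F
          (y - algebraMap F K c)⁻¹)) (IntermediateField.algebraMap_mem _ c)
        simpa using this
    rw [this]
    exact hfin

/-- All but finitely many positive integers are the pole order at `P` of a function that is
regular at all other places. -/
theorem Place.IsRational.exists_only_pole [Finite F] [IsCurveFunctionField F K] {P : Place F K}
    (hP : P.IsRational) : ∃ N₁ : ℕ, ∀ N : ℕ, N₁ ≤ N →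
      ∃ f : K, P.val f = exp (N : ℤ) ∧ ∀ S : Place F K, S ≠ P → S.val f ≤ 1 := by
  obtain ⟨x, hPx, hfin⟩ := hP.exists_pole
  have hx : x ≠ 0 := by rintro rfl; simp at hPx
  obtain ⟨n, hn⟩ := exists_approximation (F := F) x
  obtain ⟨Z, hZ, hZn⟩ := exists_finite_representatives (F := F) x hx n
  choose g hg hg' using fun N : ℕ ↦ exists_val_eq_and_le_one x P hPx N
  choose b hb hgb using fun N ↦ hn (g N)
  have hrep : ∀ N, ∃ z ∈ Z, x ^ (-n : ℤ) * (g N - b N) - z ∈ poleBounded (F := F) x (-n) :=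
    fun N ↦ hZn _ (by
      have := mul_mem_poleBounded (zpow_mem_poleBounded (F := F) x (-n)) (hgb N)
      rwa [neg_add_cancel] at this)
  choose z hz hbz using hrep
  -- Beyond `N₀` the error term does not affect the order at `P`.
  obtain ⟨N₀, hN₀⟩ : ∃ N₀ : ℕ, P.val x ^ n < exp (N₀ : ℤ) := by
    have h0 : P.val x ^ n ≠ 0 := pow_ne_zero _ (zero_lt_one.trans hPx).ne'
    refine ⟨(log (P.val x ^ n)).toNat + 1, ?_⟩
    rw [← log_lt_iff_lt_exp h0]
    have := Int.self_le_toNat (log (P.val x ^ n))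
    omega
  have hPb : ∀ N, N₀ ≤ N → P.val (b N) = exp (N : ℤ) := fun N hN ↦ by
    have h1 : P.val (g N - b N) < P.val (g N) := by
      refine (hgb N P hPx).trans_lt ?_
      rw [zpow_natCast, hg N]
      exact hN₀.trans_le (exp_le_exp.2 (by exact_mod_cast hN))
    rw [← hg N]
    rw [Valuation.map_sub_swap] at h1
    exact Valuation.map_eq_of_sub_lt _ h1
  -- The indices whose class of error terms has not occurred before.
  let E : Set ℕ := {N | N₀ ≤ N ∧ ∀ N', N₀ ≤ N' → N' < N → z N' ≠ z N}
  have hE : E.Finite := by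
    refine Set.Finite.of_finite_image (hZ.subset ?_) (f := z) ?_
    · rintro _ ⟨N, -, rfl⟩
      exact hz N
    · intro N hN N' hN' h
      rcases lt_trichotomy N N' with h1 | h1 | h1
      · exact (hN'.2 N hN.1 h1 h).elim
      · exact h1
      · exact (hN.2 N' hN'.1 h1 h.symm).elim
  obtain ⟨B, hB⟩ := hE.bddAbove
  refine ⟨max N₀ (B + 1), fun N hN ↦ ?_⟩
  have hN₁ : N₀ ≤ N := (le_max_left _ _).trans hN
  have hN₂ : N ∉ E := fun h ↦ by
    have := hB h
    have := (le_max_right _ _).trans hN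
    omega
  obtain ⟨N', hN'₀, hN'N, hzz⟩ : ∃ N', N₀ ≤ N' ∧ N' < N ∧ z N' = z N := by
    by_contra! h
    exact hN₂ ⟨hN₁, h⟩
  refine ⟨b N - b N', ?_, fun S hSP ↦ ?_⟩
  · rw [Valuation.map_sub_eq_of_lt_left, hPb N hN₁]
    rw [hPb N hN₁, hPb N' hN'₀, exp_lt_exp]
    exact_mod_cast hN'N
  · by_cases hS : 1 < S.val x
    · have h1 := sub_mem (hbz N) (hbz N')
      have h2 := mul_mem_poleBounded (zpow_mem_poleBounded (F := F) x n) h1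
      rw [add_neg_cancel] at h2
      have h3 := h2 S hS
      have h4 : x ^ (n : ℤ) * (x ^ (-n : ℤ) * (g N - b N) - z N -
          (x ^ (-n : ℤ) * (g N' - b N') - z N')) = (g N - g N') - (b N - b N') := by
        rw [hzz, sub_sub_sub_cancel_right, ← mul_sub, ← mul_assoc, ← zpow_add₀ hx]
        simp only [add_neg_cancel, zpow_zero, one_mul]
        ring
      rw [h4, zpow_zero] at h3
      have h5 := Valuation.map_sub_le _ (hg' N S hS hSP) (hg' N' S hS hSP)
      have h6 := Valuation.map_sub_le _ h5 h3
      simpa using h6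
    · exact Valuation.map_sub_le _ (hb N S (not_lt.1 hS)) (hb N' S (not_lt.1 hS))

/-- Every positive integer is the pole order at `P` of a function whose only other pole is `R`. -/
theorem Place.IsRational.exists_two_poles [Finite F] [IsCurveFunctionField F K] {P R : Place F K}
    (hP : P.IsRational) (hR : R.IsRational) (hPR : P ≠ R) (n : ℕ) :
    ∃ f : K, P.val f = exp (n : ℤ) ∧ ∀ S : Place F K, S ≠ P → S ≠ R → S.val f ≤ 1 := by
  obtain ⟨N₁, hN₁⟩ := hP.exists_only_pole
  obtain ⟨N₂, hN₂⟩ := hR.exists_only_pole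
  obtain ⟨w, hwR, hw⟩ := hN₂ (N₂ + 1) (Nat.le_succ _)
  obtain ⟨c, hc⟩ := hP.exists_value (hw P hPR)
  -- `t` vanishes at `P`, and its only pole is `R`.
  set t := w - algebraMap F K c
  have ht0 : t ≠ 0 := fun h ↦ by
    rw [sub_eq_zero.1 h] at hwR
    have h1 := R.val_algebraMap_le c
    rw [hwR, ← exp_zero, exp_le_exp] at h1
    omega
  have htv : P.val t ≠ 0 := by simpa using ht0
  obtain ⟨a, ha⟩ : ∃ a : ℕ, log (P.val t) = -(a + 1 : ℕ) := by
    have : log (P.val t) < 0 := by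
      rw [← log_one]
      exact (log_lt_log htv one_ne_zero).2 hc
    refine ⟨(-log (P.val t) - 1).toNat, ?_⟩
    push_cast
    omega
  obtain ⟨f, hf, hf'⟩ := hN₁ (n + N₁ * (a + 1))
    ((Nat.le_mul_of_pos_right _ a.succ_pos).trans (Nat.le_add_left _ _))
  refine ⟨f * t ^ N₁, ?_, fun S hSP hSR ↦ ?_⟩
  · rw [map_mul, map_pow, hf, ← exp_log htv, ha, ← exp_nsmul, ← exp_add]
    congr 1
    push_cast
    rw [nsmul_eq_mul]
    ring
  · rw [map_mul, map_pow]
    exact mul_le_one' (hf' S hSP)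
      (pow_le_one' (Valuation.map_sub_le _ (hw S hSR) (S.val_algebraMap_le c)) _)

end StrongApproximation

/-! ### Linear algebra over a finite field -/

section FiniteFieldCombinations

variable {F : Type*} [Field F] [Finite F]

/-- At most `|F|` nonzero linear forms over a finite field `F` have a common non-root. -/
theorem exists_forall_linearForm_ne_zero {V ι : Type*} [AddCommGroup V] [Module F V]
    (φ : ι → V →ₗ[F] F) (J : Finset ι) (hJ : J.card ≤ Nat.card F)
    (h : ∀ j ∈ J, ∃ v, φ j v ≠ 0) : ∃ v, ∀ j ∈ J, φ j v ≠ 0 := by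
  classical
  have := Fintype.ofFinite F
  rw [Nat.card_eq_fintype_card] at hJ
  induction J using Finset.induction_on with
  | empty => exact ⟨0, by simp⟩
  | insert i J hi ih =>
    rw [Finset.card_insert_of_notMem hi] at hJ
    obtain ⟨v, hv⟩ := ih (fun j hj ↦ h j (Finset.mem_insert_of_mem hj)) (by omega)
    obtain ⟨w, hw⟩ := h i (Finset.mem_insert_self _ _)
    by_cases hvi : φ i v ≠ 0
    · exact ⟨v, Finset.forall_mem_insert _ _ _ |>.2 ⟨hvi, hv⟩⟩
    rw [not_not] at hvi
    by_cases hwJ : ∀ j ∈ J, φ j w ≠ 0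
    · exact ⟨w, Finset.forall_mem_insert _ _ _ |>.2 ⟨hw, hwJ⟩⟩
    push Not at hwJ
    obtain ⟨j₀, hj₀, hwj₀⟩ := hwJ
    -- The form `φ j₀` vanishes at `w` but not at `v`, so it excludes no `v + c • w`.
    obtain ⟨c, hc⟩ : ∃ c, c ∉ insert 0 ((J.erase j₀).image fun j ↦ -φ j v / φ j w) := by
      by_contra! hall
      have h1 : Finset.univ ⊆ insert 0 ((J.erase j₀).image fun j ↦ -φ j v / φ j w) :=
        fun c _ ↦ hall c
      have h2 := Finset.card_le_card h1
      have h3 := Finset.card_insert_le (0 : F) ((J.erase j₀).image fun j ↦ -φ j v / φ j w)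
      have h4 := Finset.card_image_le (s := J.erase j₀) (f := fun j ↦ -φ j v / φ j w)
      rw [Finset.card_erase_of_mem hj₀] at h4
      have h5 := Finset.card_pos.2 ⟨j₀, hj₀⟩
      rw [Finset.card_univ] at h2
      omega
    rw [Finset.mem_insert, not_or, Finset.mem_image, not_exists] at hc
    refine ⟨v + c • w, Finset.forall_mem_insert _ _ _ |>.2 ⟨?_, fun j hj ↦ ?_⟩⟩
    · simpa [hvi] using ⟨hc.1, hw⟩
    · by_cases hwj : φ j w = 0
      · simpa [hwj] using hv j hj
      · intro h0
        refine hc.2 j ⟨Finset.mem_erase.2 ⟨fun hjj ↦ hwj (hjj ▸ hwj₀), hj⟩, ?_⟩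
        rw [map_add, map_smul, smul_eq_mul] at h0
        rw [div_eq_iff hwj]
        linear_combination -h0

theorem exists_ne_zero_sum_ne_zero {ι : Type*} (J : Finset ι) (hJ : J.Nonempty)
    (hcard : J.card < Nat.card F) : ∃ c : ι → F, (∀ j ∈ J, c j ≠ 0) ∧ ∑ j ∈ J, c j ≠ 0 := by
  classical
  have := Fintype.ofFinite F
  rw [Nat.card_eq_fintype_card] at hcard
  obtain ⟨j₀, hj₀⟩ := hJ
  by_cases h1 : J.card = 1
  · obtain ⟨j, rfl⟩ := Finset.card_eq_one.1 h1
    exact ⟨fun _ ↦ 1, by simp, by simp⟩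
  have h2 := Finset.card_pos.2 ⟨j₀, hj₀⟩
  obtain ⟨b, hb⟩ : ∃ b : F, b ∉ ({0, -∑ j ∈ J.erase j₀, 1} : Finset F) := by
    by_contra! hall
    have h3 := Finset.card_le_card fun (c : F) (_ : c ∈ Finset.univ) ↦ hall c
    have h4 := Finset.card_le_two (a := (0 : F)) (b := -∑ j ∈ J.erase j₀, 1)
    rw [Finset.card_univ] at h3
    omega
  rw [Finset.mem_insert, Finset.mem_singleton, not_or] at hb
  refine ⟨fun j ↦ if j = j₀ then b else 1, fun j _ ↦ ?_, ?_⟩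
  · dsimp only
    split_ifs
    exacts [hb.1, one_ne_zero]
  · rw [← Finset.add_sum_erase _ _ hj₀, if_pos rfl]
    have : ∑ j ∈ J.erase j₀, (if j = j₀ then b else 1) = ∑ j ∈ J.erase j₀, (1 : F) :=
      Finset.sum_congr rfl fun j hj ↦ if_neg (Finset.ne_of_mem_erase hj)
    rw [this]
    exact fun h ↦ hb.2 (eq_neg_of_add_eq_zero_left h)

theorem exists_ne_zero_sum_eq_zero {ι : Type*} (J : Finset ι) (hJ : 2 ≤ J.card)
    (hcard : J.card < Nat.card F) : ∃ c : ι → F, (∀ j ∈ J, c j ≠ 0) ∧ ∑ j ∈ J, c j = 0 := by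
  classical
  obtain ⟨j₀, hj₀⟩ := Finset.card_pos.1 (by omega : 0 < J.card)
  have h1 := Finset.card_erase_of_mem hj₀
  obtain ⟨c, hc, hsum⟩ := exists_ne_zero_sum_ne_zero (F := F) (J.erase j₀)
    (Finset.card_pos.1 (by omega)) (by omega)
  refine ⟨fun j ↦ if j = j₀ then -∑ j ∈ J.erase j₀, c j else c j, fun j hj ↦ ?_, ?_⟩
  · dsimp only
    split_ifs with h
    exacts [neg_ne_zero.2 hsum, hc j (Finset.mem_erase.2 ⟨h, hj⟩)]
  · rw [← Finset.add_sum_erase _ _ hj₀, if_pos rfl, neg_add_eq_zero]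
    exact Finset.sum_congr rfl fun j hj ↦ (if_neg (Finset.ne_of_mem_erase hj)).symm

end FiniteFieldCombinations

/-! ### Leading coefficients at a rational point -/

section LeadingCoefficient

variable {F K : Type*} [Field F] [Field K] [Algebra F K]

/-- `f * s` takes the value `c` at `P`. For `s` of order `n` at `P`, this says that `c` is the
coefficient of order `-n` in the expansion of `f` at `P` with respect to `s`. -/
def Place.HasLead (P : Place F K) (s f : K) (c : F) : Prop :=
  P.val (f * s - algebraMap F K c) < 1

namespace Place

variable {P : Place F K} {s f : K} {c : F} {n : ℤ}

theorem IsRational.exists_hasLead (hP : P.IsRational) (hs : P.val s = exp (-n))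
    (hf : P.val f ≤ exp n) : ∃ c, P.HasLead s f c := by
  refine hP.exists_value ?_
  rw [map_mul, hs]
  refine (mul_le_mul' hf le_rfl).trans (le_of_eq ?_)
  rw [← exp_add, add_neg_cancel, exp_zero]

theorem HasLead.val_eq (h : P.HasLead s f c) (hs : P.val s = exp (-n)) (hc : c ≠ 0) :
    P.val f = exp n := by
  have h1 : P.val (f * s) = 1 := by
    rw [← P.val_algebraMap hc]
    refine Valuation.map_eq_of_sub_lt _ ?_
    rw [P.val_algebraMap hc]
    exact h
  rw [map_mul, hs, exp_neg] at h1
  exact eq_of_div_eq_one (by rwa [div_eq_mul_inv])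

theorem HasLead.val_lt (h : P.HasLead s f 0) (hs : P.val s = exp (-n)) : P.val f < exp n := by
  unfold HasLead at h
  rwa [map_zero, sub_zero, map_mul, hs, exp_neg, mul_inv_lt_iff₀ exp_pos, one_mul] at h

theorem HasLead.ne_zero (h : P.HasLead s f c) (hs : P.val s = exp (-n)) (hf : P.val f = exp n) :
    c ≠ 0 := by
  rintro rfl
  exact (h.val_lt hs).ne hf

theorem HasLead.smul (h : P.HasLead s f c) (a : F) : P.HasLead s (a • f) (a * c) := by
  unfold HasLead
  rw [smul_mul_assoc, map_mul, ← Algebra.smul_def, ← smul_sub]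
  exact (P.val_smul_le _ _).trans_lt h

theorem HasLead.sub {g : K} {d : F} (h : P.HasLead s f c) (h' : P.HasLead s g d) :
    P.HasLead s (f - g) (c - d) := by
  unfold HasLead
  rw [sub_mul, (algebraMap F K).map_sub, sub_sub_sub_comm]
  exact Valuation.map_sub_lt _ h h'

theorem HasLead.sum {ι : Type*} {J : Finset ι} {f : ι → K} {c : ι → F}
    (h : ∀ j ∈ J, P.HasLead s (f j) (c j)) : P.HasLead s (∑ j ∈ J, f j) (∑ j ∈ J, c j) := by
  unfold HasLead
  rw [Finset.sum_mul, map_sum, ← Finset.sum_sub_distrib]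
  exact Valuation.map_sum_lt _ one_ne_zero h

theorem val_lt_exp_add_one_iff : P.val f < exp (n + 1) ↔ P.val f ≤ exp n :=
  lt_mul_exp_iff_le exp_ne_zero

end Place

end LeadingCoefficient

/-! ### Riemann-Roch spaces and the Weierstrass semigroups -/

section Semigroup

variable {F K : Type*} [Field F] [Field K] [Algebra F K] {m : ℕ}

/-- The Riemann-Roch space `L(D_δ)` of the divisor `D_δ = ∑ δᵢ Qᵢ`. -/
def rrSpace (Q : Fin m → Place F K) (δ : Fin m → ℤ) : Submodule F K where
  carrier := {f | (∀ P : Place F K, P ∉ Set.range Q → P.val f ≤ 1) ∧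
    ∀ i, (Q i).val f ≤ exp (δ i)}
  add_mem' hf hg := ⟨fun P hP ↦ Valuation.map_add_le _ (hf.1 P hP) (hg.1 P hP),
    fun i ↦ Valuation.map_add_le _ (hf.2 i) (hg.2 i)⟩
  zero_mem' := ⟨fun P _ ↦ by simp, fun i ↦ by simp⟩
  smul_mem' c _ hf := ⟨fun P hP ↦ (P.val_smul_le c _).trans (hf.1 P hP),
    fun i ↦ ((Q i).val_smul_le c _).trans (hf.2 i)⟩

variable {Q : Fin m → Place F K} {γ δ β : Fin m → ℤ} {f : K}

theorem mem_genWeierstrassSemigroup : γ ∈ genWeierstrassSemigroup Q ↔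
    ∃ f : K, f ≠ 0 ∧ (∀ P : Place F K, P ∉ Set.range Q → P.val f ≤ 1) ∧
      ∀ i, (Q i).val f = exp (γ i) := by
  constructor
  · rintro ⟨f, hf, hf0, h⟩
    exact ⟨f, hf0, fun P hP ↦ P.val_le_one_iff.2 (hf P hP),
      fun i ↦ ((Q i).eq_neg_ord_iff hf0 _).1 (h i)⟩
  · rintro ⟨f, hf0, hf, h⟩
    exact ⟨f, fun P hP ↦ P.val_le_one_iff.1 (hf P hP), hf0,
      fun i ↦ ((Q i).eq_neg_ord_iff hf0 _).2 (h i)⟩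

theorem nablaOn_nonempty_of_val {J : Finset (Fin m)} (hf0 : f ≠ 0)
    (hf : ∀ P : Place F K, P ∉ Set.range Q → P.val f ≤ 1)
    (hJ : ∀ j ∈ J, (Q j).val f = exp (β j)) (hJ' : ∀ j, j ∉ J → (Q j).val f < exp (β j)) :
    (nablaOn Q J β).Nonempty := by
  refine ⟨fun j ↦ -(Q j).ord f, ⟨fun j hj ↦ ?_, fun j hj ↦ ?_⟩, f,
    fun P hP ↦ P.val_le_one_iff.1 (hf P hP), hf0, fun _ ↦ rfl⟩
  · exact (((Q j).eq_neg_ord_iff hf0 _).2 (hJ j hj)).symm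
  · dsimp only
    rw [Place.neg_ord_eq, log_lt_iff_lt_exp (by simpa using hf0)]
    exact hJ' j hj

theorem divisorOf_apply (hQ : Function.Injective Q) (γ : Fin m → ℤ) (j : Fin m) :
    divisorOf Q γ (Q j) = γ j := by
  classical
  rw [divisorOf, Finsupp.finsetSum_apply, Finset.sum_eq_single j]
  · simp
  · intro i _ hij
    exact Finsupp.single_eq_of_ne fun h ↦ hij (hQ h.symm)
  · simp

theorem divisorOf_apply_of_notMem (γ : Fin m → ℤ) {P : Place F K} (hP : P ∉ Set.range Q) :
    divisorOf Q γ P = 0 := by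
  classical
  rw [divisorOf, Finsupp.finsetSum_apply]
  exact Finset.sum_eq_zero fun i _ ↦ Finsupp.single_eq_of_ne fun h ↦ hP ⟨i, h.symm⟩

theorem neg_ord_le_iff (P : Place F K) (hf0 : f ≠ 0) (n : ℤ) :
    -P.ord f ≤ n ↔ P.val f ≤ exp n := by
  rw [P.neg_ord_eq, log_le_iff_le_exp (by simpa using hf0)]

/-- The elements of the generalized semigroup with nonnegative coordinates belong to the
classical one. -/
theorem mem_weierstrassSemigroup_of_mem_gen (hQ : Function.Injective Q) (hγ : γ ∈ natTuples m)
    (h : γ ∈ genWeierstrassSemigroup Q) : γ ∈ weierstrassSemigroup Q := by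
  obtain ⟨f, hf0, hf, hfγ⟩ := mem_genWeierstrassSemigroup.1 h
  refine ⟨hγ, f, hf0, fun P ↦ ?_⟩
  by_cases hP : P ∈ Set.range Q
  · obtain ⟨i, rfl⟩ := hP
    rw [divisorOf_apply hQ, poleDivisor, ← ((Q i).eq_neg_ord_iff hf0 _).2 (hfγ i)]
    exact max_eq_right (hγ i)
  · rw [divisorOf_apply_of_notMem _ hP, poleDivisor]
    refine max_eq_left ((neg_ord_le_iff P hf0 0).2 ?_)
    rw [exp_zero]
    exact hf P hP

/-- If for every `i` some function in `L(D_γ)` has pole order exactly `γᵢ` at `Qᵢ`, then some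
linear combination of these functions attains all the pole orders at once. -/
theorem mem_genWeierstrassSemigroup_of_forall_exists [Finite F] [NeZero m]
    (hq : m ≤ Nat.card F) (hrat : ∀ i, (Q i).IsRational)
    (h : ∀ i, ∃ f ∈ rrSpace Q γ, (Q i).val f = exp (γ i)) :
    γ ∈ genWeierstrassSemigroup Q := by
  choose f hf hfi using h
  choose s hs using fun j ↦ (Q j).exists_val_eq (-γ j)
  choose a ha using fun j i ↦ (hrat j).exists_hasLead (hs j) ((hf i).2 j)
  let φ : Fin m → (Fin m → F) →ₗ[F] F := fun j ↦
    ∑ i, (a j i) • LinearMap.proj (R := F) (φ := fun _ : Fin m ↦ F) i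
  obtain ⟨c, hc⟩ := exists_forall_linearForm_ne_zero φ Finset.univ (by simpa using hq)
    fun j _ ↦ ⟨Pi.single j 1, by
      have : φ j (Pi.single j 1) = a j j := by
        simp [φ, LinearMap.sum_apply, Pi.single_apply]
      rw [this]
      exact (ha j j).ne_zero (hs j) (hfi j)⟩
  have hval : ∀ j, (Q j).val (∑ i, c i • f i) = exp (γ j) := fun j ↦ by
    have h1 : (Q j).HasLead (s j) (∑ i, c i • f i) (∑ i, c i * a j i) :=
      Place.HasLead.sum fun i _ ↦ (ha j i).smul (c i)
    refine h1.val_eq (hs j) ?_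
    have h2 := hc j (Finset.mem_univ _)
    simpa [φ, LinearMap.sum_apply, mul_comm] using h2
  have hmem : ∑ i, c i • f i ∈ rrSpace Q γ :=
    sum_mem fun i _ ↦ Submodule.smul_mem _ _ (hf i)
  exact mem_genWeierstrassSemigroup.2
    ⟨_, (Q 0).ne_zero_of_val_eq_exp (hval 0), hmem.1, hval⟩

/-- For `β` maximal with nonnegative coordinates, the nonnegative points of `∇̄(β)` are gaps. -/
theorem mem_gaps_of_mem_nablaBar (hQ : Function.Injective Q) (hβ : IsMaximal Q β)
    (hβ0 : β ∈ natTuples m) (hγ : γ ∈ nablaBar β) (hγ0 : γ ∈ natTuples m) : γ ∈ gaps Q := by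
  refine ⟨hγ0, ?_⟩
  rintro ⟨-, h, h0, hh⟩
  obtain ⟨i, hi, hi'⟩ := Set.mem_iUnion.1 hγ
  simp only [Finset.mem_singleton, forall_eq] at hi hi'
  refine Set.notMem_empty _ (hβ.2 ▸ ?_ : (fun j ↦ if β i = 0 then 0 else -(Q j).ord h) ∈
    (∅ : Set (Fin m → ℤ)))
  have hord : ∀ j, max 0 (-(Q j).ord h) = γ j := fun j ↦ by
    rw [← divisorOf_apply hQ γ j, ← hh (Q j), poleDivisor]
  by_cases hi0 : β i = 0
  · -- A constant function already contradicts the maximality of `β`.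
    simp only [hi0, if_true]
    refine ⟨Set.mem_iUnion.2 ⟨i, by simp [hi0], fun j hj ↦ ?_⟩,
      mem_genWeierstrassSemigroup.2 ⟨1, one_ne_zero, by simp, by simp⟩⟩
    exact (hγ0 j).trans_lt (hi' j (by simpa using hj))
  · simp only [hi0, if_false]
    refine ⟨Set.mem_iUnion.2 ⟨i, fun j hj ↦ ?_, fun j hj ↦ ?_⟩, h, fun P hP ↦ ?_, h0, fun _ ↦ rfl⟩
    · rw [Finset.mem_singleton.1 hj]
      have h1 := hord i
      have h2 := hβ0 i
      grind
    · exact ((le_max_right _ _).trans (hord j).le).trans_lt (hi' j (by simpa using hj))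
    · have h1 := hh P
      rw [divisorOf_apply_of_notMem _ hP, poleDivisor] at h1
      rw [← P.val_le_one_iff, ← exp_zero, ← neg_ord_le_iff P h0]
      exact (le_max_right _ _).trans h1.le

end Semigroup

/-! ### Construction of relative maximal elements -/

section RelativeMaximal

variable {F K : Type*} [Field F] [Field K] [Algebra F K] {m : ℕ}
  {Q : Fin m → Place F K} {γ δ : Fin m → ℤ} {i : Fin m}

/-- Among the divisors `D_δ` with `δ ≥ γ` and `δᵢ = γᵢ` for which no function in `L(D_δ)` has
pole order exactly `γᵢ` at `Qᵢ`, there is a maximal one: a function whose only poles are `Qᵢ`,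
of order `γᵢ`, and `Qⱼ` bounds the coordinate `δⱼ`. -/
theorem exists_maximal_of_forall_val_ne [Finite F] [IsCurveFunctionField F K]
    (hQ : Function.Injective Q) (hrat : ∀ i, (Q i).IsRational) (hγ : γ ∈ natTuples m)
    (hi : ∀ f ∈ rrSpace Q γ, (Q i).val f ≠ exp (γ i)) :
    ∃ δ, Maximal (· ∈ {δ : Fin m → ℤ | γ ≤ δ ∧ δ i = γ i ∧
      ∀ f ∈ rrSpace Q δ, (Q i).val f ≠ exp (γ i)}) δ := by
  have hbound : ∀ j, ∃ N : ℤ, ∀ δ : Fin m → ℤ, γ ≤ δ → δ i = γ i →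
      (∀ f ∈ rrSpace Q δ, (Q i).val f ≠ exp (γ i)) → δ j ≤ N := fun j ↦ by
    by_cases hij : j = i
    · exact ⟨γ i, fun δ _ h _ ↦ hij ▸ h.le⟩
    obtain ⟨f, hf, hf'⟩ := (hrat i).exists_two_poles (hrat j) (fun h ↦ hij (hQ h).symm)
      (γ i).toNat
    rw [Int.toNat_of_nonneg (hγ i)] at hf
    have hf0 := (Q i).ne_zero_of_val_eq_exp hf
    refine ⟨log ((Q j).val f), fun δ hγδ hδi hδ ↦ ?_⟩
    by_contra! hlt
    refine hδ f ⟨fun P hP ↦ hf' P ?_ ?_, fun k ↦ ?_⟩ hf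
    · rintro rfl
      exact hP ⟨i, rfl⟩
    · rintro rfl
      exact hP ⟨j, rfl⟩
    · by_cases hki : k = i
      · rw [hki, hf, hδi]
      by_cases hkj : k = j
      · rw [hkj]
        exact le_exp_of_log_le hlt.le
      · refine (hf' _ (fun h ↦ hki (hQ h)) fun h ↦ hkj (hQ h)).trans ?_
        rw [← exp_zero, exp_le_exp]
        exact (hγ k).trans (hγδ k)
  choose N hN using hbound
  exact ((Set.finite_Icc γ N).subset fun δ h ↦
    ⟨h.1, fun j ↦ hN j δ h.1 h.2.1 h.2.2⟩).exists_maximal ⟨γ, le_rfl, rfl, hi⟩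

/-- At a maximal `δ`, for each `j ≠ i` a function in `L(D_δ + Qⱼ)` attains both the pole order
`γᵢ` at `Qᵢ` and the pole order `δⱼ + 1` at `Qⱼ`. -/
theorem exists_val_eq_of_maximal (hrat : ∀ i, (Q i).IsRational)
    (hδ : Maximal (· ∈ {δ : Fin m → ℤ | γ ≤ δ ∧ δ i = γ i ∧
      ∀ f ∈ rrSpace Q δ, (Q i).val f ≠ exp (γ i)}) δ)
    {s : K} (hs : (Q i).val s = exp (-γ i)) {j : Fin m} (hj : j ≠ i) :
    ∃ f : K, (∀ P : Place F K, P ∉ Set.range Q → P.val f ≤ 1) ∧ (Q i).HasLead s f 1 ∧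
      (Q j).val f = exp (δ j + 1) ∧ ∀ k ≠ j, (Q k).val f ≤ exp (δ k) := by
  classical
  obtain ⟨⟨hγδ, hδi, hδf⟩, hmax⟩ := hδ
  have hle : δ ≤ Function.update δ j (δ j + 1) := by
    rw [le_update_self_iff]
    exact (lt_add_one _).le
  obtain ⟨f, hf, hfi⟩ : ∃ f ∈ rrSpace Q (Function.update δ j (δ j + 1)),
      (Q i).val f = exp (γ i) := by
    by_contra! h
    have := hmax (y := Function.update δ j (δ j + 1))
      ⟨hγδ.trans hle, by rw [Function.update_of_ne hj.symm, hδi], h⟩ hle j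
    rw [Function.update_self] at this
    exact (lt_add_one (δ j)).not_ge this
  have hfk : ∀ k ≠ j, (Q k).val f ≤ exp (δ k) := fun k hk ↦ by
    have := hf.2 k
    rwa [Function.update_of_ne hk] at this
  have hfj : (Q j).val f = exp (δ j + 1) := by
    have h1 := hf.2 j
    rw [Function.update_self] at h1
    refine h1.antisymm (not_lt.1 fun h2 ↦ hδf f ⟨hf.1, fun k ↦ ?_⟩ hfi)
    by_cases hk : k = j
    · rw [hk]
      exact Place.val_lt_exp_add_one_iff.1 h2
    · exact hfk k hk
  obtain ⟨l, hl⟩ := (hrat i).exists_hasLead hs hfi.le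
  have hl0 := hl.ne_zero hs hfi
  have hl0' := inv_ne_zero hl0
  refine ⟨l⁻¹ • f, fun P hP ↦ (P.val_smul_le _ _).trans (hf.1 P hP), ?_, ?_, fun k hk ↦ ?_⟩
  · have := hl.smul l⁻¹
    rwa [inv_mul_cancel₀ hl0] at this
  · rw [(Q j).val_smul hl0', hfj]
  · rw [(Q k).val_smul hl0']
    exact hfk k hk

/-- If no function in `L(D_γ)` has pole order exactly `γᵢ` at `Qᵢ`, then `γ ∈ ∇̄ᵢ(β)` for a
relative maximal `β`. With `δ` maximal as in `exists_maximal_of_forall_val_ne`, one takes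
`βᵢ = γᵢ` and `βⱼ = δⱼ + 1` for `j ≠ i`; the functions that `β` has to have are linear combinations
of those in `exists_val_eq_of_maximal`. -/
theorem exists_natRelMaximals_of_forall_val_ne [Finite F] [IsCurveFunctionField F K]
    (hm : 2 ≤ m) (hq : m ≤ Nat.card F)
    (hQ : Function.Injective Q) (hrat : ∀ i, (Q i).IsRational) (hγ : γ ∈ natTuples m)
    (hi : ∀ f ∈ rrSpace Q γ, (Q i).val f ≠ exp (γ i)) :
    ∃ β ∈ natRelMaximals Q, γ ∈ nablaBar β := by
  classical
  obtain ⟨δ, hδ⟩ := exists_maximal_of_forall_val_ne hQ hrat hγ hi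
  obtain ⟨s, hs⟩ := (Q i).exists_val_eq (-γ i)
  choose! f hfreg hflead hfj hfk using
    fun j (hj : j ≠ i) ↦ exists_val_eq_of_maximal hrat hδ hs hj
  obtain ⟨⟨hγδ, hδi, hδf⟩, -⟩ := hδ
  set β : Fin m → ℤ := fun j ↦ if j = i then γ i else δ j + 1 with hβ
  have hβi : β i = γ i := if_pos rfl
  have hβj : ∀ j ≠ i, β j = δ j + 1 := fun j hj ↦ if_neg hj
  have hfi : ∀ j ≠ i, (Q i).val (f j) = exp (γ i) := fun j hj ↦ (hflead j hj).val_eq hs one_ne_zero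
  -- The values of the linear combinations of the `f j` over `j ∈ J`.
  have comb_reg : ∀ (J : Finset (Fin m)) (c : Fin m → F), i ∉ J →
      ∀ P : Place F K, P ∉ Set.range Q → P.val (∑ j ∈ J, c j • f j) ≤ 1 := fun J c hJ P hP ↦
    Valuation.map_sum_le _ fun j hj ↦ (P.val_smul_le _ _).trans
      (hfreg j (fun h ↦ hJ (h ▸ hj)) P hP)
  have comb_lead : ∀ (J : Finset (Fin m)) (c : Fin m → F), i ∉ J →
      (Q i).HasLead s (∑ j ∈ J, c j • f j) (∑ j ∈ J, c j) := fun J c hJ ↦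
    Place.HasLead.sum fun j hj ↦ by
      simpa using (hflead j fun h ↦ hJ (h ▸ hj)).smul (c j)
  have comb_lt : ∀ (J : Finset (Fin m)) (c : Fin m → F), i ∉ J →
      ∀ k, k ∉ J → k ≠ i → (Q k).val (∑ j ∈ J, c j • f j) < exp (β k) :=
    fun J c hJ k hk hki ↦ by
      rw [hβj k hki, Place.val_lt_exp_add_one_iff]
      exact Valuation.map_sum_le _ fun j hj ↦ ((Q k).val_smul_le _ _).trans
        (hfk j (fun h ↦ hJ (h ▸ hj)) k fun h ↦ hk (h ▸ hj))
  have comb_eq : ∀ (J : Finset (Fin m)) (c : Fin m → F), i ∉ J → (∀ j ∈ J, c j ≠ 0) →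
      ∀ k ∈ J, (Q k).val (∑ j ∈ J, c j • f j) = exp (β k) := fun J c hJ hc k hk ↦ by
    have hki : k ≠ i := fun h ↦ hJ (h ▸ hk)
    have h1 : (Q k).val (c k • f k) = exp (β k) := by
      rw [(Q k).val_smul (hc k hk), hβj k hki, hfj k hki]
    have h2 := comb_lt (J.erase k) c (fun h ↦ hJ (Finset.mem_of_mem_erase h)) k
      (Finset.notMem_erase k J) hki
    rw [← Finset.add_sum_erase _ _ hk, Valuation.map_add_eq_of_lt_left _ (h2.trans_eq h1.symm), h1]
  have hcard : (Finset.univ.erase i).card = m - 1 := by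
    rw [Finset.card_erase_of_mem (Finset.mem_univ _), Finset.card_univ, Fintype.card_fin]
  refine ⟨β, ⟨⟨⟨?_, ?_⟩, fun J hJ hJ2 ↦ Set.nonempty_iff_ne_empty.1 ?_⟩, fun j ↦ ?_⟩,
    Set.mem_iUnion.2 ⟨i, ?_, ?_⟩⟩
  · -- `β` belongs to the semigroup.
    obtain ⟨c, hc, hsum⟩ := exists_ne_zero_sum_ne_zero (F := F) (Finset.univ.erase i)
      (Finset.card_pos.1 (by omega)) (by omega)
    have hiJ := Finset.notMem_erase i Finset.univ
    have hvi := (comb_lead _ c hiJ).val_eq hs hsum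
    refine mem_genWeierstrassSemigroup.2 ⟨_, (Q i).ne_zero_of_val_eq_exp hvi,
      comb_reg _ c hiJ, fun k ↦ ?_⟩
    by_cases hk : k = i
    · rw [hk, hvi, hβi]
    · exact comb_eq _ c hiJ hc k (Finset.mem_erase.2 ⟨hk, Finset.mem_univ _⟩)
  · -- `β` is maximal.
    rw [nabla, Set.eq_empty_iff_forall_notMem]
    rintro α ⟨hα, hαg⟩
    obtain ⟨g, hg0, hg, hgα⟩ := mem_genWeierstrassSemigroup.1 hαg
    obtain ⟨k, hk, hk'⟩ := Set.mem_iUnion.1 hα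
    simp only [Finset.mem_singleton, forall_eq] at hk hk'
    have hgle : ∀ l, l ≠ k → l ≠ i → (Q l).val g ≤ exp (δ l) := fun l hlk hli ↦ by
      rw [hgα, exp_le_exp]
      have := hk' l hlk
      rw [hβj l hli] at this
      omega
    by_cases hki : k = i
    · subst hki
      refine hδf g ⟨hg, fun l ↦ ?_⟩ (by rw [hgα, hk, hβi])
      by_cases hl : l = k
      · rw [hl, hgα, hk, hβi, hδi]
      · exact hgle l hl hl
    · -- Cancelling the pole of order `δ k + 1` of `f k` with `g` leaves an element of `L(D_δ)`.
      have hfgk : (Q k).val g = exp (δ k + 1) := by rw [hgα, hk, hβj k hki]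
      obtain ⟨t, ht⟩ := (Q k).exists_val_eq (-(δ k + 1))
      obtain ⟨a, ha⟩ := (hrat k).exists_hasLead ht (hfj k hki).le
      obtain ⟨b, hb⟩ := (hrat k).exists_hasLead ht hfgk.le
      have hb0 := hb.ne_zero ht hfgk
      have hgi : (Q i).val ((a / b) • g) < (Q i).val (f k) := by
        refine ((Q i).val_smul_le _ _).trans_lt ?_
        rw [hfi k hki, hgα, exp_lt_exp, ← hβi]
        exact hk' i fun h ↦ hki h.symm
      have hvi : (Q i).val (f k - (a / b) • g) = exp (γ i) := by
        rw [Valuation.map_sub_eq_of_lt_left _ hgi, hfi k hki]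
      refine hδf (f k - (a / b) • g) ⟨fun P hP ↦ Valuation.map_sub_le _ (hfreg k hki P hP)
        ((P.val_smul_le _ _).trans (hg P hP)), fun l ↦ ?_⟩ hvi
      by_cases hli : l = i
      · rw [hli, hvi, hδi]
      by_cases hlk : l = k
      · have h1 := ha.sub (hb.smul (a / b))
        rw [div_mul_cancel₀ _ hb0, sub_self] at h1
        rw [hlk, ← Place.val_lt_exp_add_one_iff]
        exact h1.val_lt ht
      · exact Valuation.map_sub_le _ (hfk k hki l hlk)
          (((Q l).val_smul_le _ _).trans (hgle l hlk hli))
  · have hJcard : J.card < m := by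
      simpa using Finset.card_lt_card hJ
    by_cases hiJ : i ∈ J
    · have h1 := Finset.card_erase_of_mem hiJ
      have hiE := Finset.notMem_erase i J
      obtain ⟨c, hc, hsum⟩ := exists_ne_zero_sum_ne_zero (F := F) (J.erase i)
        (Finset.card_pos.1 (by omega)) (by omega)
      have hvi := (comb_lead _ c hiE).val_eq hs hsum
      refine nablaOn_nonempty_of_val ((Q i).ne_zero_of_val_eq_exp hvi) (comb_reg _ c hiE)
        (fun k hk ↦ ?_) fun k hk ↦ ?_
      · by_cases hki : k = i
        · rw [hki, hvi, hβi]
        · exact comb_eq _ c hiE hc k (Finset.mem_erase.2 ⟨hki, hk⟩)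
      · exact comb_lt _ c hiE k (fun h ↦ hk (Finset.mem_of_mem_erase h)) fun h ↦ hk (h ▸ hiJ)
    · obtain ⟨c, hc, hsum⟩ := exists_ne_zero_sum_eq_zero (F := F) J hJ2 (by omega)
      obtain ⟨k₀, hk₀⟩ := Finset.card_pos.1 (by omega : 0 < J.card)
      refine nablaOn_nonempty_of_val
        ((Q k₀).ne_zero_of_val_eq_exp (comb_eq J c hiJ hc k₀ hk₀)) (comb_reg _ c hiJ)
        (comb_eq J c hiJ hc) fun k hk ↦ ?_
      by_cases hki : k = i
      · have h1 := comb_lead J c hiJ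
        rw [hsum] at h1
        rw [hki, hβi]
        exact h1.val_lt hs
      · exact comb_lt J c hiJ k hk hki
  · by_cases hj : j = i
    · rw [hj, hβi]
      exact hγ i
    · rw [hβj j hj]
      exact ((hγ j).trans (hγδ j)).trans (lt_add_one _).le
  · intro j hj
    rw [Finset.mem_singleton.1 hj, hβi]
  · intro j hj
    rw [hβj j (by simpa using hj)]
    exact Int.lt_add_one_of_le (hγδ j)

end RelativeMaximal

end AlgCurve

end

theorem theorem3p1 {F K : Type*} [Field F] [Finite F] [Field K] [Algebra F K]
    [AlgCurve.IsCurveFunctionField F K] (m : ℕ) (hm : 2 ≤ m) (hq : m ≤ Nat.card F)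
    (Q : Fin m → AlgCurve.Place F K) (hQ : Function.Injective Q)
    (hrat : ∀ i, (Q i).IsRational) :
    AlgCurve.gaps Q =
      ⋃ β ∈ AlgCurve.natRelMaximals Q, AlgCurve.nablaBar β ∩ AlgCurve.natTuples m := by
  have : NeZero m := ⟨by omega⟩
  refine Set.Subset.antisymm (fun γ hγ ↦ ?_) (Set.iUnion₂_subset ?_)
  · by_cases h : ∀ i, ∃ f ∈ AlgCurve.rrSpace Q γ, (Q i).val f = WithZero.exp (γ i)
    · exact (hγ.2 (AlgCurve.mem_weierstrassSemigroup_of_mem_gen hQ hγ.1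
        (AlgCurve.mem_genWeierstrassSemigroup_of_forall_exists hq hrat h))).elim
    · push Not at h
      obtain ⟨i, hi⟩ := h
      obtain ⟨β, hβ, hγβ⟩ :=
        AlgCurve.exists_natRelMaximals_of_forall_val_ne hm hq hQ hrat hγ.1 hi
      exact Set.mem_iUnion₂.2 ⟨β, hβ, hγβ, hγ.1⟩
  · rintro β ⟨hβ, hβ0⟩ γ ⟨hγ, hγ0⟩
    exact AlgCurve.mem_gaps_of_mem_nablaBar hQ hβ.1 hβ0 hγ hγ0
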